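/- **Theorem (mixing time bound).** Let $1 \le m \le n$ and let $G$ be the complete bipartite graph with vertex classes $V_1$, $V_2$, $|V_1| = m$, $|V_2| = n$. Let $\mathcal N$ be the set of perfect matchings of $G$, i.e. of the maximal matchings (each has $m$ edges). Let $U : \mathcal N \to \mathbb R$ be arbitrary, with maximum $U_{\max}$ and minimum $U_{\min}$, let $\beta \in [0,\infty)$, and put $\alpha = \exp\{\beta(U_{\max}-U_{\min})\}$. Consider the following Markov chain $\mathcal M$ on $\mathcal N$. In state $M$, choose $y \in V_1$ and $z \in V_2$ independently and uniformly at random, and define a proposal $\tilde M$: if $(y,z)\in M$, then $\tilde M = M$; if $(y,z_1) \in M$ and $z$ is unmatched, then $\tilde M = (M \cup\{(y,z)\})\setminus\{(y,z_1)\}$; if $(y,z_1),(y_1,z)\in M$ with $y_1 \ne y$, then $\tilde M = (M\cup\{(y,z),(y_1,z_1)\})\setminus\{(y,z_1),(y_1,z)\}$. Move to $\tilde M$ with probability $a(M,\tilde M) = \min\{1, e^{\beta(U(\tilde M)-U(M))}\}$, and otherwise stay at $M$. Let $P$ be the transition matrix of $\mathcal M$. Then the Gibbs distribution $\pi_M =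 e^{\beta U(M)}/\sum_{M'\in\mathcal N} e^{\beta U(M')}$ is the unique stationary distribution of $P$. Moreover, with $$d(t) = \tfrac12 \max_{M'\in\mathcal N}\sum_{M\in\mathcal N}\bigl|(P^{t})_{M'M}-\pi_M\bigr| ,$$ for every $0<\varepsilon\le 1$ the $\varepsilon$-mixing time $\tau_\varepsilon = \min\{t \in \{0,1,2,\dots\} : d(t)\le\varepsilon\}$ exists and satisfies $$\tau_\varepsilon \le 32\, m^2 n^2 \alpha^6 \bigl(\beta(U_{\max}-U_{\min}) + m \ln n + \ln \varepsilon^{-1}\bigr).$$ The same two assertions hold for the lazy form of the chain, in which each state $M' \neq M$ that can be proposed from $M$ is entered with probability $\frac{1}{2mn}\,a(M,M')$, and the chain stays at $M$ with the remaining probability. -/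

import Mathlib

namespace MatchingChain

/-- A matching of the complete bipartite graph on `Fin m` and `Fin n`: a set of edges `(y, z)`,
no two of which share an endpoint. -/
def IsMatching {m n : ℕ} (M : Finset (Fin m × Fin n)) : Prop :=
  ∀ e ∈ M, ∀ f ∈ M, e ≠ f → e.1 ≠ f.1 ∧ e.2 ≠ f.2

/-- A perfect matching: a matching to which no further edge can be added. -/
def IsPerfectMatching {m n : ℕ} (M : Finset (Fin m × Fin n)) : Prop :=
  IsMatching M ∧ ∀ e : Fin m × Fin n, e ∉ M → ¬ IsMatching (insert e M)

instance {m n : ℕ} : DecidablePred (IsMatching (m := m) (n := n)) := fun M => by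
  unfold IsMatching; infer_instance

instance {m n : ℕ} : DecidablePred (IsPerfectMatching (m := m) (n := n)) := fun M => by
  unfold IsPerfectMatching; infer_instance

/-- The state space: all perfect matchings. -/
abbrev PerfectMatching (m n : ℕ) : Type :=
  {M : Finset (Fin m × Fin n) // IsPerfectMatching M}

/-- The edge set proposed from `M` when the nodes `y` and `z` are selected: the edges of `M` at
`y` or at `z` are removed, the edge `(y, z)` is added, and if `(y, z₁)` and `(y₁, z)` are both in
`M` then `(y₁, z₁)` is added too.
So if `(y, z) ∈ M` the result is `M`; if `(y, z₁) ∈ M` and `z` is unmatched it is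
`(M ∪ {(y, z)}) \ {(y, z₁)}`; if `(y, z₁), (y₁, z) ∈ M` with `y₁ ≠ y` it is
`(M ∪ {(y, z), (y₁, z₁)}) \ {(y, z₁), (y₁, z)}`. -/
def proposalEdges {m n : ℕ} (M : Finset (Fin m × Fin n)) (y : Fin m) (z : Fin n) :
    Finset (Fin m × Fin n) :=
  {e ∈ M | e.1 ≠ y ∧ e.2 ≠ z} ∪ {(y, z)} ∪
    Finset.univ.filter (fun e : Fin m × Fin n => (y, e.2) ∈ M ∧ (e.1, z) ∈ M)

theorem mem_proposalEdges {m n : ℕ} {M : Finset (Fin m × Fin n)} {y : Fin m} {z : Fin n}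
    {a : Fin m} {b : Fin n} :
    (a, b) ∈ proposalEdges M y z ↔
      ((a, b) ∈ M ∧ a ≠ y ∧ b ≠ z) ∨ (a = y ∧ b = z) ∨ ((y, b) ∈ M ∧ (a, z) ∈ M) := by
  simp only [proposalEdges, Finset.mem_union, Finset.mem_filter, Finset.mem_singleton,
    Finset.mem_univ, true_and, Prod.mk.injEq, or_assoc, ne_eq]

theorem isMatching_iff {m n : ℕ} {M : Finset (Fin m × Fin n)} :
    IsMatching M ↔
      (∀ a b b', (a, b) ∈ M → (a, b') ∈ M → b = b') ∧
      (∀ a a' b, (a, b) ∈ M → (a', b) ∈ M → a = a') := by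
  constructor
  · intro h
    constructor
    · intro a b b' h1 h2
      by_contra hne
      exact (h _ h1 _ h2 (by simpa using hne)).1 rfl
    · intro a a' b h1 h2
      by_contra hne
      exact (h _ h1 _ h2 (by simpa using hne)).2 rfl
  · rintro ⟨h1, h2⟩ ⟨a, b⟩ he ⟨a', b'⟩ hf hne
    constructor
    · rintro rfl
      exact hne (by rw [h1 _ _ _ he hf])
    · rintro rfl
      exact hne (by rw [h2 _ _ _ he hf])

theorem isPerfectMatching_iff {m n : ℕ} {M : Finset (Fin m × Fin n)} :
    IsPerfectMatching M ↔
      IsMatching M ∧ ∀ a b, (∃ b', (a, b') ∈ M) ∨ (∃ a', (a', b) ∈ M) := by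
  constructor
  · rintro ⟨h, hmax⟩
    refine ⟨h, fun a b => ?_⟩
    by_contra hc
    push Not at hc
    obtain ⟨h1, h2⟩ := hc
    refine hmax (a, b) (h1 b) ?_
    rw [isMatching_iff] at h ⊢
    obtain ⟨g1, g2⟩ := h
    simp only [Finset.mem_insert, Prod.mk.injEq]
    constructor <;> grind
  · rintro ⟨h, hmax⟩
    refine ⟨h, ?_⟩
    rintro ⟨a, b⟩ hab hm
    rw [isMatching_iff] at hm
    obtain ⟨g1, g2⟩ := hm
    rcases hmax a b with ⟨b', hb⟩ | ⟨a', ha⟩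
    · have := g1 a b b' (by simp) (by simp [hb])
      exact hab (this ▸ hb)
    · have := g2 a a' b (by simp) (by simp [ha])
      exact hab (this ▸ ha)

theorem isPerfectMatching_proposalEdges {m n : ℕ} {M : Finset (Fin m × Fin n)}
    (hM : IsPerfectMatching M) (y : Fin m) (z : Fin n) :
    IsPerfectMatching (proposalEdges M y z) := by
  rw [isPerfectMatching_iff, isMatching_iff] at hM ⊢
  obtain ⟨⟨h1, h2⟩, h3⟩ := hM
  simp only [mem_proposalEdges]
  refine ⟨⟨?_, ?_⟩, ?_⟩
  · grind
  · grind
  · intro a b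
    have e1 := h3 a b
    have e2 := h3 y b
    have e3 := h3 a z
    grind

/-- The proposed perfect matching when the nodes `y` and `z` are selected in state `M`. -/
def propose {m n : ℕ} (M : PerfectMatching m n) (y : Fin m) (z : Fin n) : PerfectMatching m n :=
  ⟨proposalEdges M.1 y z, isPerfectMatching_proposalEdges M.2 y z⟩

/-- The probability of accepting the proposal `M'` in state `M`. -/
noncomputable def acceptProb {m n : ℕ} (β : ℝ) (U : PerfectMatching m n → ℝ)
    (M M' : PerfectMatching m n) : ℝ :=
  min 1 (Real.exp (β * (U M' - U M)))

/-- The transition matrix of the algorithm (entry `M M'`: the probability of going from `M` to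
`M'`): select `(y, z)` uniformly at random, move to the proposal with the acceptance probability,
and stay at `M` otherwise. -/
noncomputable def algorithmMatrix {m n : ℕ} (β : ℝ) (U : PerfectMatching m n → ℝ) :
    Matrix (PerfectMatching m n) (PerfectMatching m n) ℝ :=
  fun M M' => ∑ y : Fin m, ∑ z : Fin n, 1 / ((m : ℝ) * n) *
    ((if propose M y z = M' then acceptProb β U M (propose M y z) else 0) +
      (if M = M' then 1 - acceptProb β U M (propose M y z) else 0))

/-- Two distinct states are adjacent if one step of the algorithm can propose the second from the
first. -/
def Adjacent {m n : ℕ} (M M' : PerfectMatching m n) : Prop :=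
  M ≠ M' ∧ ∃ y z, propose M y z = M'

instance {m n : ℕ} : DecidableRel (Adjacent (m := m) (n := n)) := fun M M' => by
  unfold Adjacent; infer_instance

/-- The lazy form of the transition matrix: every adjacent state `M'` is entered from `M` with
probability `a(M, M') / (2mn)`, and the remaining probability (at least `1/2`) is that of staying
at `M`. -/
noncomputable def lazyMatrix {m n : ℕ} (β : ℝ) (U : PerfectMatching m n → ℝ) :
    Matrix (PerfectMatching m n) (PerfectMatching m n) ℝ :=
  fun M M' =>
    if M = M' then
      1 - ∑ N : PerfectMatching m n,
        if Adjacent M N then 1 / (2 * (m : ℝ) * n) * acceptProb β U M N else 0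
    else if Adjacent M M' then 1 / (2 * (m : ℝ) * n) * acceptProb β U M M' else 0

/-- The Gibbs distribution. -/
noncomputable def gibbs {m n : ℕ} (β : ℝ) (U : PerfectMatching m n → ℝ) :
    PerfectMatching m n → ℝ :=
  fun M => Real.exp (β * U M) / ∑ M' : PerfectMatching m n, Real.exp (β * U M')

/-- `π` is a stationary distribution of the chain with transition matrix `P`. -/
def IsStationaryDistribution {S : Type*} [Fintype S] (P : Matrix S S ℝ) (π : S → ℝ) : Prop :=
  (∀ x, 0 ≤ π x) ∧ ∑ x, π x = 1 ∧ Matrix.vecMul π P = π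

/-- The total variation distance `d(t)` of the `t`-step transition probabilities from `π`, for the
worst initial state. -/
noncomputable def tvDistance {S : Type*} [Fintype S] [DecidableEq S] (P : Matrix S S ℝ)
    (π : S → ℝ) (t : ℕ) : ℝ :=
  1 / 2 * ⨆ x : S, ∑ y : S, |(P ^ t) x y - π y|

/-- `τ` is the `ε`-mixing time: the least `t` with `d(t) ≤ ε`. -/
def IsMixingTime {S : Type*} [Fintype S] [DecidableEq S] (P : Matrix S S ℝ)
    (π : S → ℝ) (ε : ℝ) (τ : ℕ) : Prop :=
  IsLeast {t : ℕ | tvDistance P π t ≤ ε} τ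

/-- The maximal utility of a perfect matching. -/
noncomputable def Umax {m n : ℕ} (U : PerfectMatching m n → ℝ) : ℝ := ⨆ M, U M

/-- The minimal utility of a perfect matching. -/
noncomputable def Umin {m n : ℕ} (U : PerfectMatching m n → ℝ) : ℝ := ⨅ M, U M

/-- `α = exp(β (U_max - U_min))`. -/
noncomputable def alpha {m n : ℕ} (β : ℝ) (U : PerfectMatching m n → ℝ) : ℝ :=
  Real.exp (β * (Umax U - Umin U))

end MatchingChain

/-! Since m ≤ n, a perfect matching is an injection `φ` of `Fin m` into `Fin n`, and the symmetric
group of `Fin n` acts transitively on these. Proposing `(y, z)` amounts to composing `φ` with the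
transposition of `φ y` and `z` (`propose_ofEmbedding`), so the chain is a Metropolis walk driven by
transpositions.

For the uniform weight, the L² displacement of a function under a permutation is subadditive. A
permutation is a product of transpositions, at most one per point, so Cauchy–Schwarz bounds every
displacement by the sum over transpositions. Averaging over the group yields a Poincaré inequality
on the adjacency graph (`sum_sum_sq_sub_le_adjacent`). Gibbs weights differ from a constant by at
most a factor α, so the inequality passes to the chain with a loss of powers of α
(`gibbs_poincare`).

With detailed balance and a lower bound on the holding probabilities, this confines the quadratic
form of `P` on mean-zero functions to `±(1 - δ)` times the squared norm. Polarization then makes `P`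
an L² contraction, without any diagonalization (`sum_mulVec_sq_le`). Uniqueness of the stationary
law and geometric decay of `d(t)` both follow, and the smallest Gibbs weight controls the starting
error. -/

namespace MatchingChain

/-! ### Reversible chains: from a Poincaré inequality to mixing -/

section Reversible

variable {S : Type*} [Fintype S]

/-- Detailed balance, with positive weights summing to one and unit row sums. -/
structure IsReversible (P : Matrix S S ℝ) (π : S → ℝ) : Prop where
  pos : ∀ x, 0 < π x
  sum_eq_one : ∑ x, π x = 1
  row_sum : ∀ x, ∑ y, P x y = 1
  balance : ∀ x y, π x * P x y = π y * P y x

theorem IsReversible.sum_mulVec {P : Matrix S S ℝ} {π : S → ℝ} (h : IsReversible P π)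
    (f : S → ℝ) : ∑ x, π x * P.mulVec f x = ∑ x, π x * f x := by
  simp only [Matrix.mulVec, dotProduct, Finset.mul_sum]
  rw [Finset.sum_comm]
  refine Finset.sum_congr rfl fun y _ => ?_
  calc ∑ x, π x * (P x y * f y) = ∑ x, π y * f y * P y x :=
        Finset.sum_congr rfl fun x _ => by linear_combination f y * h.balance x y
    _ = π y * f y := by rw [← Finset.mul_sum, h.row_sum, mul_one]

theorem IsReversible.sum_mul_mulVec_comm {P : Matrix S S ℝ} {π : S → ℝ} (h : IsReversible P π)
    (f g : S → ℝ) : ∑ x, π x * f x * P.mulVec g x = ∑ x, π x * g x * P.mulVec f x := by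
  simp only [Matrix.mulVec, dotProduct, Finset.mul_sum]
  rw [Finset.sum_comm]
  refine Finset.sum_congr rfl fun y _ => Finset.sum_congr rfl fun x _ => ?_
  linear_combination f x * g y * h.balance x y

/-- The form `∑ π x P x y (f x + s f y)²` for `s = ± 1`. -/
theorem IsReversible.sum_sq_add {P : Matrix S S ℝ} {π : S → ℝ} (h : IsReversible P π)
    (f : S → ℝ) (s : ℝ) (hs : s ^ 2 = 1) :
    ∑ x, ∑ y, π x * P x y * (f x + s * f y) ^ 2 =
      2 * ∑ x, π x * f x ^ 2 + 2 * s * ∑ x, π x * f x * P.mulVec f x := by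
  have e1 : ∑ x, ∑ y, π x * P x y * f x ^ 2 = ∑ x, π x * f x ^ 2 := by
    refine Finset.sum_congr rfl fun x _ => ?_
    calc ∑ y, π x * P x y * f x ^ 2 = ∑ y, π x * f x ^ 2 * P x y :=
          Finset.sum_congr rfl fun y _ => by ring
      _ = _ := by rw [← Finset.mul_sum, h.row_sum, mul_one]
  have e2 : ∑ x, ∑ y, π x * P x y * f y ^ 2 = ∑ x, π x * f x ^ 2 := by
    rw [← e1, Finset.sum_comm]
    exact Finset.sum_congr rfl fun x _ => Finset.sum_congr rfl fun y _ => by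
      rw [h.balance]
  have e3 : ∑ x, ∑ y, π x * P x y * (f x * f y) = ∑ x, π x * f x * P.mulVec f x := by
    simp only [Matrix.mulVec, dotProduct, Finset.mul_sum]
    exact Finset.sum_congr rfl fun x _ => Finset.sum_congr rfl fun y _ => by ring
  calc _ = ∑ x, ∑ y, (π x * P x y * f x ^ 2 + π x * P x y * f y ^ 2
          + 2 * s * (π x * P x y * (f x * f y))) :=
        Finset.sum_congr rfl fun x _ => Finset.sum_congr rfl fun y _ => by
          linear_combination π x * P x y * f y ^ 2 * hs
    _ = _ := by
        simp only [Finset.sum_add_distrib, ← Finset.mul_sum, e1, e2, e3]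
        ring

theorem sum_sum_mul_sub_sq {π : S → ℝ} (hπ : ∑ x, π x = 1) {f : S → ℝ}
    (hf : ∑ x, π x * f x = 0) :
    ∑ x, ∑ y, π x * π y * (f x - f y) ^ 2 = 2 * ∑ x, π x * f x ^ 2 := by
  calc _ = ∑ x, ∑ y, (π x * f x ^ 2 * π y + π x * (π y * f y ^ 2)
          - 2 * (π x * f x) * (π y * f y)) :=
        Finset.sum_congr rfl fun x _ => Finset.sum_congr rfl fun y _ => by ring
    _ = _ := by
        simp only [Finset.sum_add_distrib, Finset.sum_sub_distrib, ← Finset.mul_sum, hf, hπ,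
          ← Finset.sum_mul]
        ring

/-- A spectral gap `δ`, as a Poincaré inequality together with a lower bound for the holding
probabilities that keeps the spectrum away from `-1`. -/
structure HasGap (P : Matrix S S ℝ) (π : S → ℝ) (δ : ℝ) : Prop extends IsReversible P π where
  nonneg : ∀ x y, 0 ≤ P x y
  gap_pos : 0 < δ
  gap_lt_one : δ < 1
  le_diag : ∀ x, δ ≤ 2 * P x x
  poincare : ∀ f : S → ℝ, δ * ∑ x, ∑ y, π x * π y * (f x - f y) ^ 2 ≤
    ∑ x, ∑ y, π x * P x y * (f x - f y) ^ 2

namespace HasGap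

variable {P : Matrix S S ℝ} {π : S → ℝ} {δ : ℝ}

theorem sum_mul_mulVec_le (h : HasGap P π δ) {f : S → ℝ} (hf : ∑ x, π x * f x = 0) :
    ∑ x, π x * f x * P.mulVec f x ≤ (1 - δ) * ∑ x, π x * f x ^ 2 := by
  have h1 := h.poincare f
  have h2 := h.sum_sq_add f (-1) (by norm_num)
  rw [sum_sum_mul_sub_sq h.sum_eq_one hf] at h1
  simp only [neg_mul, one_mul, ← sub_eq_add_neg] at h2
  linarith

/-- The diagonal terms of the form with `s = 1` equal `4 π x P x x f x ^ 2`, which is at least `2 δ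
π x f x ^ 2`; all other terms are nonnegative. -/
theorem neg_le_sum_mul_mulVec (h : HasGap P π δ) (f : S → ℝ) :
    -((1 - δ) * ∑ x, π x * f x ^ 2) ≤ ∑ x, π x * f x * P.mulVec f x := by
  have h2 := h.sum_sq_add f 1 (by norm_num)
  have h3 : 2 * δ * ∑ x, π x * f x ^ 2 ≤ ∑ x, ∑ y, π x * P x y * (f x + 1 * f y) ^ 2 := by
    rw [Finset.mul_sum]
    refine Finset.sum_le_sum fun x _ => ?_
    refine le_trans ?_ (Finset.single_le_sum (f := fun y => π x * P x y * (f x + 1 * f y) ^ 2)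
      (fun y _ => mul_nonneg (mul_nonneg (h.pos x).le (h.nonneg x y)) (sq_nonneg _))
      (Finset.mem_univ x))
    have := mul_le_mul_of_nonneg_right (h.le_diag x)
      (mul_nonneg (h.pos x).le (sq_nonneg (f x)))
    linarith
  linarith

/-- Polarization: the upper bound is applied to `f + g` and the lower bound to `f - g`; the
parallelogram law collects the squares. -/
theorem two_mul_sum_mul_mulVec_le (h : HasGap P π δ) {f g : S → ℝ} (hf : ∑ x, π x * f x = 0)
    (hg : ∑ x, π x * g x = 0) :
    2 * ∑ x, π x * g x * P.mulVec f x ≤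
      (1 - δ) * (∑ x, π x * f x ^ 2 + ∑ x, π x * g x ^ 2) := by
  have hfg : ∑ x, π x * (f + g) x = 0 := by
    simp only [Pi.add_apply, mul_add, Finset.sum_add_distrib, hf, hg, add_zero]
  have h1 := h.sum_mul_mulVec_le hfg
  have h2 := h.neg_le_sum_mul_mulVec (f - g)
  have e1 : ∑ x, π x * (f + g) x * P.mulVec (f + g) x - ∑ x, π x * (f - g) x * P.mulVec (f - g) x
      = 4 * ∑ x, π x * g x * P.mulVec f x := by
    have := h.sum_mul_mulVec_comm f g
    calc _ = 2 * ∑ x, π x * f x * P.mulVec g x + 2 * ∑ x, π x * g x * P.mulVec f x := by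
          rw [Matrix.mulVec_add, Matrix.mulVec_sub, Finset.mul_sum, Finset.mul_sum,
            ← Finset.sum_sub_distrib, ← Finset.sum_add_distrib]
          exact Finset.sum_congr rfl fun x _ => by
            simp only [Pi.add_apply, Pi.sub_apply]; ring
      _ = _ := by rw [this]; ring
  have e2 : ∑ x, π x * (f + g) x ^ 2 + ∑ x, π x * (f - g) x ^ 2
      = 2 * (∑ x, π x * f x ^ 2 + ∑ x, π x * g x ^ 2) := by
    rw [← Finset.sum_add_distrib, ← Finset.sum_add_distrib, Finset.mul_sum]
    exact Finset.sum_congr rfl fun x _ => by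
      simp only [Pi.add_apply, Pi.sub_apply]; ring
  linear_combination (1 / 2 : ℝ) * h1 + (1 / 2 : ℝ) * h2 - (1 / 2 : ℝ) * e1
    + (1 / 2 : ℝ) * (1 - δ) * e2

/-- The bilinear bound is tested on `g = (1 - δ)⁻¹ P f`, the scaling for which the two squared norms
recombine into the contraction factor. -/
theorem sum_mulVec_sq_le (h : HasGap P π δ) {f : S → ℝ} (hf : ∑ x, π x * f x = 0) :
    ∑ x, π x * P.mulVec f x ^ 2 ≤ (1 - δ) ^ 2 * ∑ x, π x * f x ^ 2 := by
  have hc : 0 < 1 - δ := by linarith [h.gap_lt_one]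
  set c := 1 - δ with hcdef
  have hg : ∑ x, π x * (c⁻¹ • P.mulVec f) x = 0 := by
    have := h.sum_mulVec f
    calc _ = c⁻¹ * ∑ x, π x * P.mulVec f x := by
          rw [Finset.mul_sum]
          exact Finset.sum_congr rfl fun x _ => by simp only [Pi.smul_apply, smul_eq_mul]; ring
      _ = 0 := by rw [this, hf, mul_zero]
  have key := h.two_mul_sum_mul_mulVec_le hf hg
  have e1 : ∑ x, π x * (c⁻¹ • P.mulVec f) x * P.mulVec f x
      = c⁻¹ * ∑ x, π x * P.mulVec f x ^ 2 := by
    rw [Finset.mul_sum]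
    exact Finset.sum_congr rfl fun x _ => by simp only [Pi.smul_apply, smul_eq_mul]; ring
  have e2 : ∑ x, π x * (c⁻¹ • P.mulVec f) x ^ 2
      = c⁻¹ ^ 2 * ∑ x, π x * P.mulVec f x ^ 2 := by
    rw [Finset.mul_sum]
    exact Finset.sum_congr rfl fun x _ => by simp only [Pi.smul_apply, smul_eq_mul]; ring
  rw [e1, e2, ← hcdef] at key
  set A := ∑ x, π x * P.mulVec f x ^ 2
  set B := ∑ x, π x * f x ^ 2
  have key2 := mul_le_mul_of_nonneg_left key hc.le
  field_simp at key2
  linarith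

theorem isStationary_iff (h : HasGap P π δ) (ν : S → ℝ) :
    IsStationaryDistribution P ν ↔ ν = π := by
  constructor
  · rintro ⟨-, h1, h2⟩
    -- The density of `ν` minus one has mean zero and, by detailed balance, is fixed by `P`; a
    -- strict contraction leaves only zero.
    have hne : ∀ x, π x ≠ 0 := fun x => (h.pos x).ne'
    set f : S → ℝ := fun x => ν x / π x - 1 with hfdef
    have hπf : ∀ x, π x * f x = ν x - π x := fun x => by
      simp only [hfdef]; field_simp [hne x]
    have hf : ∑ x, π x * f x = 0 := by
      simp only [hπf, Finset.sum_sub_distrib, h1, h.sum_eq_one, sub_self]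
    have hPf : P.mulVec f = f := by
      funext x
      have hx : π x * P.mulVec f x = π x * f x := by
        calc π x * P.mulVec f x = ∑ y, (ν y * P y x - π x * P x y) := by
              simp only [Matrix.mulVec, dotProduct, Finset.mul_sum]
              refine Finset.sum_congr rfl fun y _ => ?_
              linear_combination (f y + 1) * h.balance x y + P y x * hπf y
          _ = π x * f x := by
              rw [Finset.sum_sub_distrib, ← Finset.mul_sum, h.row_sum, hπf]
              have := congrFun h2 x
              simp only [Matrix.vecMul, dotProduct] at this
              rw [this, mul_one]
      exact mul_left_cancel₀ (hne x) hx
    have key := h.sum_mulVec_sq_le hf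
    rw [hPf] at key
    have hB : ∀ x ∈ Finset.univ, 0 ≤ π x * f x ^ 2 := fun x _ =>
      mul_nonneg (h.pos x).le (sq_nonneg _)
    have h0 : ∑ x, π x * f x ^ 2 = 0 := by
      refine le_antisymm ?_ (Finset.sum_nonneg hB)
      have h3 : 0 < 1 - (1 - δ) ^ 2 := by nlinarith [h.gap_pos, h.gap_lt_one]
      by_contra hcon
      push Not at hcon
      nlinarith
    funext x
    have hx := (Finset.sum_eq_zero_iff_of_nonneg hB).1 h0 x (Finset.mem_univ x)
    have hfx : f x = 0 := by simpa [hne x] using hx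
    have := hπf x
    rw [hfx, mul_zero] at this
    linarith
  · rintro rfl
    refine ⟨fun x => (h.pos x).le, h.sum_eq_one, ?_⟩
    funext y
    simp only [Matrix.vecMul, dotProduct]
    calc ∑ x, ν x * P x y = ∑ x, ν y * P y x := Finset.sum_congr rfl fun x _ => h.balance x y
      _ = ν y := by rw [← Finset.mul_sum, h.row_sum, mul_one]

/-- The relative density of the `t`-step distribution started from `x`, minus one. -/
theorem exists_density [DecidableEq S] (h : HasGap P π δ) (x : S) (t : ℕ) :
    ∃ f : S → ℝ, (∀ y, (P ^ t) x y = π y * (1 + f y)) ∧ ∑ y, π y * f y = 0 ∧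
      ∑ y, π y * f y ^ 2 ≤ ((1 - δ) ^ t) ^ 2 * (π x)⁻¹ := by
  have hne : ∀ x, π x ≠ 0 := fun x => (h.pos x).ne'
  induction t with
  | zero =>
    have e : ∀ y, (P ^ 0) x y = π y * (1 + ((if x = y then (π x)⁻¹ else 0) - 1)) := by
      intro y
      rw [pow_zero, Matrix.one_apply]
      split_ifs with hxy
      · subst hxy; field_simp [hne x]; ring
      · ring
    have e2 : ∀ y, π y * ((if x = y then (π x)⁻¹ else 0) - 1) = (if x = y then 1 else 0) - π y := by
      intro y
      have := e y
      rw [pow_zero, Matrix.one_apply] at this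
      linarith
    refine ⟨fun y => (if x = y then (π x)⁻¹ else 0) - 1, e, ?_, ?_⟩
    · simp only [e2, Finset.sum_sub_distrib, h.sum_eq_one]; simp
    · have : ∀ y, π y * ((if x = y then (π x)⁻¹ else 0) - 1) ^ 2
          = (if x = y then (π x)⁻¹ - 2 else 0) + π y := by
        intro y
        split_ifs with hxy
        · subst hxy; field_simp [hne x]; ring
        · ring
      simp only [this, Finset.sum_add_distrib, h.sum_eq_one]
      simp
      linarith
  | succ t ih =>
    obtain ⟨f, h1, h2, h3⟩ := ih
    -- Detailed balance turns a step of the distribution into `P` acting on its density.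
    refine ⟨P.mulVec f, ?_, ?_, ?_⟩
    · intro y
      rw [pow_succ, Matrix.mul_apply]
      calc ∑ z, (P ^ t) x z * P z y = ∑ z, (π y * P y z + π y * (P y z * f z)) :=
            Finset.sum_congr rfl fun z _ => by
              rw [h1]; linear_combination (1 + f z) * h.balance z y
        _ = _ := by
            rw [Finset.sum_add_distrib, ← Finset.mul_sum, ← Finset.mul_sum, h.row_sum]
            simp only [Matrix.mulVec, dotProduct]
            ring
    · rw [h.sum_mulVec, h2]
    · refine (h.sum_mulVec_sq_le h2).trans ?_
      calc (1 - δ) ^ 2 * ∑ y, π y * f y ^ 2 ≤ (1 - δ) ^ 2 * (((1 - δ) ^ t) ^ 2 * (π x)⁻¹) :=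
            mul_le_mul_of_nonneg_left h3 (sq_nonneg _)
        _ = _ := by ring

/-- Cauchy–Schwarz with weights `π` bounds the L¹ distance by the L² norm of the relative density
minus one. -/
theorem tvDistance_le [DecidableEq S] [Nonempty S] (h : HasGap P π δ) {L : ℝ}
    (hL : ∀ x, Real.exp (-L) ≤ π x) (t : ℕ) :
    tvDistance P π t ≤ 1 / 2 * ((1 - δ) ^ t * Real.exp (L / 2)) := by
  unfold tvDistance
  refine mul_le_mul_of_nonneg_left (ciSup_le fun x => ?_) (by norm_num)
  obtain ⟨f, h1, -, h3⟩ := h.exists_density x t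
  have hc : 0 ≤ 1 - δ := by linarith [h.gap_lt_one]
  refine abs_le_of_sq_le_sq' ?_ (by positivity) |>.2
  calc (∑ y, |(P ^ t) x y - π y|) ^ 2 = (∑ y, π y * |f y|) ^ 2 := by
        congr 1
        refine Finset.sum_congr rfl fun y _ => ?_
        rw [h1, show π y * (1 + f y) - π y = π y * f y by ring, abs_mul, abs_of_pos (h.pos y)]
    _ ≤ (∑ y, π y) * ∑ y, π y * f y ^ 2 := by
        refine Finset.sum_sq_le_sum_mul_sum_of_sq_le_mul _ (fun y _ => (h.pos y).le)
          (fun y _ => mul_nonneg (h.pos y).le (sq_nonneg _)) fun y _ => ?_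
        rw [mul_pow, sq_abs]; exact le_of_eq (by ring)
    _ ≤ ((1 - δ) ^ t) ^ 2 * (π x)⁻¹ := by rw [h.sum_eq_one, one_mul]; exact h3
    _ ≤ ((1 - δ) ^ t) ^ 2 * Real.exp L := by
        refine mul_le_mul_of_nonneg_left ?_ (sq_nonneg _)
        rw [← neg_neg L, Real.exp_neg]
        exact inv_anti₀ (Real.exp_pos _) (hL x)
    _ = ((1 - δ) ^ t * Real.exp (L / 2)) ^ 2 := by
        rw [mul_pow, ← Real.exp_nat_mul]; congr 2; push_cast; ring

theorem exists_mixingTime_le [DecidableEq S] [Nonempty S] (h : HasGap P π δ)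
    (hδ : δ ≤ 1 / 2) {L ε : ℝ} (hL0 : 0 ≤ L) (hL : ∀ x, Real.exp (-L) ≤ π x) (hε : 0 < ε)
    (hε1 : ε ≤ 1) :
    ∃ τ : ℕ, IsMixingTime P π ε τ ∧ (τ : ℝ) ≤ δ⁻¹ * (L + Real.log ε⁻¹) := by
  set T := δ⁻¹ * (L + Real.log ε⁻¹) with hT
  have hlog : 0 ≤ Real.log ε⁻¹ := Real.log_nonneg ((one_le_inv₀ hε).2 hε1)
  have hT0 : 0 ≤ T := mul_nonneg (inv_nonneg.2 h.gap_pos.le) (add_nonneg hL0 hlog)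
  have hδT : δ * T = L + Real.log ε⁻¹ := by
    rw [hT, ← mul_assoc, mul_inv_cancel₀ h.gap_pos.ne', one_mul]
  have hmem : tvDistance P π ⌊T⌋₊ ≤ ε := by
    refine (h.tvDistance_le hL _).trans ?_
    have h1 : (1 - δ) ^ ⌊T⌋₊ ≤ Real.exp (-δ * ⌊T⌋₊) := by
      rw [mul_comm, Real.exp_nat_mul]
      exact pow_le_pow_left₀ (by linarith) (by linarith [Real.add_one_le_exp (-δ)]) _
    -- Rounding `T` down costs at most a factor `exp δ ≤ exp (1 / 2) ≤ 2`, which the `1 / 2` in the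
    -- total variation distance absorbs.
    have h2 : Real.exp (-δ * ⌊T⌋₊) * Real.exp (L / 2) ≤ Real.exp (1 / 2) * ε := by
      calc _ ≤ Real.exp (1 / 2 + Real.log ε) := by
            rw [← Real.exp_add, Real.exp_le_exp]
            have := Nat.lt_floor_add_one T
            rw [Real.log_inv] at hδT
            nlinarith [h.gap_pos]
        _ = _ := by rw [Real.exp_add, Real.exp_log hε]
    have h3 : Real.exp (1 / 2) ≤ 2 := by
      have := Real.exp_one_lt_d9
      have h4 : Real.exp (1 / 2) ^ 2 = Real.exp 1 := by
        rw [← Real.exp_nat_mul]; norm_num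
      nlinarith [Real.exp_pos (1 / 2)]
    have h5 := mul_le_mul_of_nonneg_right h1 (Real.exp_pos (L / 2)).le
    have h6 := mul_le_mul_of_nonneg_right h3 hε.le
    linarith
  classical
  have hex : ∃ t, tvDistance P π t ≤ ε := ⟨_, hmem⟩
  refine ⟨Nat.find hex, ⟨Nat.find_spec hex, fun t ht => Nat.find_min' hex ht⟩, ?_⟩
  exact (Nat.cast_le.2 (Nat.find_min' hex hmem)).trans (Nat.floor_le hT0)

end HasGap

end Reversible

/-! ### Poincaré inequality for transpositions acting transitively -/

section PermutationAction

variable {X : Type*} [Fintype X] {n : ℕ} [MulAction (Equiv.Perm (Fin n)) X]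

theorem sum_smul {G : Type*} [Group G] [MulAction G X] (g : G) (h : X → ℝ) :
    ∑ x, h (g • x) = ∑ x, h x :=
  Equiv.sum_comp (MulAction.toPerm g) h

/-- By transitivity the group sum does not depend on `x`: moving `x` only reindexes the group by a
right multiplication. Summing over all points and exchanging sums finishes. -/
theorem card_mul_sum_smul {G : Type*} [Group G] [Fintype G] [MulAction G X]
    [MulAction.IsPretransitive G X] (h : X → ℝ) (x : X) :
    (Fintype.card X : ℝ) * ∑ g : G, h (g • x) = Fintype.card G * ∑ y, h y := by
  have hconst : ∀ y, ∑ g : G, h (g • y) = ∑ g : G, h (g • x) := by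
    intro y
    obtain ⟨k, rfl⟩ := MulAction.exists_smul_eq G x y
    simp only [smul_smul]
    exact Equiv.sum_comp (Equiv.mulRight k) fun g => h (g • x)
  calc (Fintype.card X : ℝ) * ∑ g : G, h (g • x) = ∑ y, ∑ g : G, h (g • y) := by
        simp only [hconst, Finset.sum_const, Finset.card_univ, nsmul_eq_mul]
    _ = _ := by
        rw [Finset.sum_comm]
        simp only [sum_smul, Finset.sum_const, Finset.card_univ, nsmul_eq_mul]

/-- The root of the sum of `(f x - f (g x))²`. -/
noncomputable def displacement (f : X → ℝ) (g : Equiv.Perm (Fin n)) : ℝ :=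
  ‖WithLp.toLp 2 fun x => f x - f (g • x)‖

theorem displacement_sq (f : X → ℝ) (g : Equiv.Perm (Fin n)) :
    displacement f g ^ 2 = ∑ x, (f x - f (g • x)) ^ 2 := by
  simp [displacement, EuclideanSpace.norm_sq_eq]

/-- Minkowski's inequality through the intermediate point `h • x`; acting by `h` permutes `X`, so it
does not change the norm. -/
theorem displacement_mul_le (f : X → ℝ) (g h : Equiv.Perm (Fin n)) :
    displacement f (g * h) ≤ displacement f g + displacement f h := by
  have e : displacement f g = ‖WithLp.toLp 2 fun x => f (h • x) - f (g • h • x)‖ := by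
    refine (sq_eq_sq₀ (norm_nonneg _) (norm_nonneg _)).1 ((displacement_sq f g).trans ?_)
    simp only [EuclideanSpace.norm_sq_eq, Real.norm_eq_abs, sq_abs]
    exact (sum_smul h fun x => (f x - f (g • x)) ^ 2).symm
  rw [e, add_comm]
  refine le_trans (le_of_eq ?_) (norm_add_le _ _)
  rw [displacement, ← WithLp.toLp_add]
  congr 2
  funext x
  simp [mul_smul]

/-- Multiplying `g` by the transposition of `k` and `g k` yields a permutation that also fixes `k`,
so points are peeled off one at a time. `B k` is uniform in the partner because `g k` is arbitrary.
-/
theorem displacement_le_sum (f : X → ℝ) (B : Fin n → ℝ)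
    (hB : ∀ k a, displacement f (Equiv.swap k a) ≤ B k) (s : Finset (Fin n)) :
    ∀ g : Equiv.Perm (Fin n), (∀ k ∉ s, g k = k) → displacement f g ≤ ∑ k ∈ s, B k := by
  induction s using Finset.induction_on with
  | empty =>
    intro g hg
    have : g = 1 := Equiv.ext fun k => hg k (Finset.notMem_empty k)
    simp only [this, displacement, one_smul, sub_self, Finset.sum_empty]
    exact (norm_eq_zero.2 rfl).le
  | insert k s hk ih =>
    intro g hg
    have hfix : ∀ j ∉ s, (Equiv.swap k (g k) * g) j = j := by
      intro j hj
      by_cases hjk : j = k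
      · subst hjk; simp
      · have hgj : g j = j := hg j (by simp [hj, hjk])
        rw [Equiv.Perm.mul_apply, hgj]
        refine Equiv.swap_apply_of_ne_of_ne hjk fun h => hjk ?_
        exact g.injective (hgj.trans h)
    have hmul : g = Equiv.swap k (g k) * (Equiv.swap k (g k) * g) := by
      rw [← mul_assoc, Equiv.swap_mul_self, one_mul]
    rw [Finset.sum_insert hk]
    calc displacement f g = displacement f (Equiv.swap k (g k) * (Equiv.swap k (g k) * g)) := by
          rw [← hmul]
      _ ≤ _ := (displacement_mul_le _ _ _).trans (add_le_add (hB _ _) (ih _ hfix))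

theorem sum_sq_sub_smul_le (f : X → ℝ) (g : Equiv.Perm (Fin n)) :
    ∑ x, (f x - f (g • x)) ^ 2 ≤
      n * ∑ k : Fin n, ∑ a : Fin n, ∑ x, (f x - f (Equiv.swap k a • x)) ^ 2 := by
  set D : Fin n → ℝ := fun k => ∑ a : Fin n, ∑ x, (f x - f (Equiv.swap k a • x)) ^ 2 with hD
  have hD0 : ∀ k, 0 ≤ D k := fun k =>
    Finset.sum_nonneg fun a _ => Finset.sum_nonneg fun x _ => sq_nonneg _
  -- `D k` sums over all partners of `k`, so its root dominates each single displacement.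
  have h := displacement_le_sum f (fun k => √(D k)) (fun k a => by
    refine Real.le_sqrt_of_sq_le ?_
    rw [displacement_sq]
    exact Finset.single_le_sum (f := fun a => ∑ x, (f x - f (Equiv.swap k a • x)) ^ 2)
      (fun a _ => Finset.sum_nonneg fun x _ => sq_nonneg _) (Finset.mem_univ a))
    Finset.univ g (fun k hk => absurd (Finset.mem_univ k) hk)
  rw [← displacement_sq]
  calc displacement f g ^ 2 ≤ (∑ k, √(D k)) ^ 2 := pow_le_pow_left₀ (norm_nonneg _) h 2
    _ ≤ (Finset.univ : Finset (Fin n)).card * ∑ k, √(D k) ^ 2 := sq_sum_le_card_mul_sum_sq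
    _ = n * ∑ k, D k := by simp [Real.sq_sqrt (hD0 _)]

theorem sum_sum_sq_sub_le [MulAction.IsPretransitive (Equiv.Perm (Fin n)) X] (f : X → ℝ) :
    ∑ x, ∑ y, (f x - f y) ^ 2 ≤ Fintype.card X *
      (n * ∑ k : Fin n, ∑ a : Fin n, ∑ x, (f x - f (Equiv.swap k a • x)) ^ 2) := by
  set G := Equiv.Perm (Fin n)
  set R := (n * ∑ k : Fin n, ∑ a : Fin n, ∑ x, (f x - f (Equiv.swap k a • x)) ^ 2 : ℝ)
  have hG : (0 : ℝ) < Fintype.card G := Nat.cast_pos.2 Fintype.card_pos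
  refine le_of_mul_le_mul_left ?_ hG
  calc (Fintype.card G : ℝ) * ∑ x, ∑ y, (f x - f y) ^ 2
      = ∑ x, (Fintype.card X : ℝ) * ∑ g : G, (f x - f (g • x)) ^ 2 := by
        rw [Finset.mul_sum]
        exact Finset.sum_congr rfl fun x _ =>
          (card_mul_sum_smul (G := G) (fun y => (f x - f y) ^ 2) x).symm
    _ = Fintype.card X * ∑ g : G, ∑ x, (f x - f (g • x)) ^ 2 := by
        rw [← Finset.mul_sum, Finset.sum_comm]
    _ ≤ Fintype.card X * ∑ _g : G, R :=
        mul_le_mul_of_nonneg_left (Finset.sum_le_sum fun g _ => sum_sq_sub_smul_le f g)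
          (Nat.cast_nonneg _)
    _ = _ := by simp only [Finset.sum_const, Finset.card_univ, nsmul_eq_mul]; ring

end PermutationAction

/-! ### Perfect matchings as injections -/

section Embeddings

variable {m n : ℕ}

/-- If `y` were unmatched, maximality would match every vertex of `Fin n`; the partner map into `Fin
m` is injective, hence bijective as m ≤ n, and so hits `y`. -/
theorem exists_mem_of_isPerfectMatching (hmn : m ≤ n) {M : Finset (Fin m × Fin n)}
    (hM : IsPerfectMatching M) (y : Fin m) : ∃ z, (y, z) ∈ M := by
  by_contra hy
  push Not at hy
  obtain ⟨h1, h2⟩ := isPerfectMatching_iff.1 hM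
  have h3 : ∀ z, ∃ y', (y', z) ∈ M := fun z =>
    (h2 y z).resolve_left fun ⟨b, hb⟩ => hy b hb
  choose c hc using h3
  have hinj : Function.Injective c := fun z z' hz =>
    (isMatching_iff.1 h1).1 (c z) z z' (hc z) (hz ▸ hc z')
  have hbij := (Fintype.bijective_iff_injective_and_card c).2
    ⟨hinj, le_antisymm (Fintype.card_le_of_injective c hinj) (by simpa using hmn)⟩
  obtain ⟨z, hz⟩ := hbij.2 y
  exact hy z (hz ▸ hc z)

/-- The perfect matching with the edges `(y, φ y)`. -/
def ofEmbedding (φ : Fin m ↪ Fin n) : PerfectMatching m n :=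
  ⟨Finset.univ.filter fun e => φ e.1 = e.2, by
    rw [isPerfectMatching_iff, isMatching_iff]
    refine ⟨⟨?_, ?_⟩, ?_⟩
    · simp only [Finset.mem_filter, Finset.mem_univ, true_and]
      exact fun a b b' h h' => h.symm.trans h'
    · simp only [Finset.mem_filter, Finset.mem_univ, true_and]
      exact fun a a' b h h' => φ.injective (h.trans h'.symm)
    · exact fun a b => Or.inl ⟨φ a, by simp⟩⟩

@[simp] theorem mem_ofEmbedding (φ : Fin m ↪ Fin n) (a : Fin m) (b : Fin n) :
    (a, b) ∈ (ofEmbedding φ).1 ↔ φ a = b := by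
  simp [ofEmbedding]

theorem ofEmbedding_bijective (hmn : m ≤ n) :
    Function.Bijective (ofEmbedding : (Fin m ↪ Fin n) → PerfectMatching m n) := by
  constructor
  · intro φ ψ h
    ext a : 1
    have : (a, φ a) ∈ (ofEmbedding ψ).1 := h ▸ (mem_ofEmbedding φ a _).2 rfl
    exact ((mem_ofEmbedding ψ a _).1 this).symm
  · intro M
    choose φ hφ using exists_mem_of_isPerfectMatching hmn M.2
    obtain ⟨h1, h2⟩ := isMatching_iff.1 M.2.1
    refine ⟨⟨φ, fun a a' h => h2 a a' (φ a) (hφ a) (h ▸ hφ a')⟩, Subtype.ext (Finset.ext ?_)⟩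
    rintro ⟨a, b⟩
    rw [mem_ofEmbedding]
    exact ⟨fun h => h ▸ hφ a, fun h => h1 a _ _ (hφ a) h⟩

/-- One transposition covers every case: it moves only `y` if `z` is free, exchanges two partners if
`z` is taken, and is the identity if `z = φ y`. -/
theorem propose_ofEmbedding (φ : Fin m ↪ Fin n) (y : Fin m) (z : Fin n) :
    propose (ofEmbedding φ) y z = ofEmbedding (Equiv.swap (φ y) z • φ) := by
  refine Subtype.ext (Finset.ext ?_)
  rintro ⟨a, b⟩
  have hinj : φ a = φ y ↔ a = y := φ.injective.eq_iff
  rw [mem_ofEmbedding, propose, mem_proposalEdges]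
  simp only [mem_ofEmbedding, Function.Embedding.smul_apply, Equiv.Perm.smul_def,
    Equiv.swap_apply_def]
  grind

theorem propose_eq_iff (φ ψ : Fin m ↪ Fin n) (hmn : m ≤ n) (y : Fin m) (z : Fin n) :
    propose (ofEmbedding φ) y z = ofEmbedding ψ ↔
      z = ψ y ∧ Equiv.swap (φ y) (ψ y) • φ = ψ := by
  rw [propose_ofEmbedding, (ofEmbedding_bijective hmn).1.eq_iff]
  constructor
  · rintro rfl
    simp
  · rintro ⟨rfl, h⟩
    exact h

theorem swap_smul_eq_comm (φ ψ : Fin m ↪ Fin n) (y : Fin m) :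
    Equiv.swap (φ y) (ψ y) • φ = ψ ↔ Equiv.swap (ψ y) (φ y) • ψ = φ := by
  rw [Equiv.swap_comm (ψ y), eq_comm, ← inv_smul_eq_iff, Equiv.swap_inv]

/-- For each `y` only `z = ψ y` can lead from `φ` to `ψ`, and a transposition is its own inverse, so
the proposal counts agree for each `y`. -/
theorem sum_propose_comm (hmn : m ≤ n) (M M' : PerfectMatching m n) :
    (∑ y : Fin m, ∑ z : Fin n, if propose M y z = M' then (1 : ℝ) else 0) =
      ∑ y : Fin m, ∑ z : Fin n, if propose M' y z = M then (1 : ℝ) else 0 := by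
  obtain ⟨φ, rfl⟩ := (ofEmbedding_bijective hmn).2 M
  obtain ⟨ψ, rfl⟩ := (ofEmbedding_bijective hmn).2 M'
  refine Finset.sum_congr rfl fun y _ => ?_
  simp only [propose_eq_iff _ _ hmn, swap_smul_eq_comm φ ψ, ite_and, Finset.sum_ite_eq',
    Finset.mem_univ, if_true]

theorem Adjacent.symm (hmn : m ≤ n) {M M' : PerfectMatching m n} (h : Adjacent M M') :
    Adjacent M' M := by
  obtain ⟨φ, rfl⟩ := (ofEmbedding_bijective hmn).2 M
  obtain ⟨ψ, rfl⟩ := (ofEmbedding_bijective hmn).2 M'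
  obtain ⟨hne, y, z, hyz⟩ := h
  refine ⟨hne.symm, y, φ y, ?_⟩
  rw [propose_eq_iff _ _ hmn] at hyz ⊢
  exact ⟨rfl, (swap_smul_eq_comm φ ψ y).1 hyz.2⟩

theorem eq_or_eq_of_swap_smul {φ ψ : Fin m ↪ Fin n} {y : Fin m} (hy : φ y ≠ ψ y) {k a : Fin n}
    (h : Equiv.swap k a • φ = ψ) : (k = φ y ∧ a = ψ y) ∨ (k = ψ y ∧ a = φ y) := by
  have h1 : Equiv.swap k a (φ y) = ψ y := by rw [← h]; rfl
  rw [Equiv.swap_apply_def] at h1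
  grind

theorem adjacent_of_swap_smul (hmn : m ≤ n) {φ ψ : Fin m ↪ Fin n} {y : Fin m} (hy : φ y ≠ ψ y)
    {k a : Fin n} (h : Equiv.swap k a • φ = ψ) :
    Adjacent (ofEmbedding φ) (ofEmbedding ψ) := by
  refine ⟨fun hc => hy (by rw [(ofEmbedding_bijective hmn).1 hc]), y, ψ y, ?_⟩
  rw [propose_eq_iff _ _ hmn]
  refine ⟨rfl, ?_⟩
  rcases eq_or_eq_of_swap_smul hy h with ⟨rfl, rfl⟩ | ⟨rfl, rfl⟩
  · exact h
  · rw [Equiv.swap_comm]; exact h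

theorem sum_swap_ite_le (hmn : m ≤ n) (F : PerfectMatching m n → ℝ) (φ ψ : Fin m ↪ Fin n) :
    (∑ k : Fin n, ∑ a : Fin n, if Equiv.swap k a • φ = ψ then
        (F (ofEmbedding φ) - F (ofEmbedding ψ)) ^ 2 else 0) ≤
      2 * if Adjacent (ofEmbedding φ) (ofEmbedding ψ) then
        (F (ofEmbedding φ) - F (ofEmbedding ψ)) ^ 2 else 0 := by
  set c := (F (ofEmbedding φ) - F (ofEmbedding ψ)) ^ 2 with hc
  have hc0 : 0 ≤ c := sq_nonneg _
  by_cases hne : φ = ψ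
  · have : c = 0 := by rw [hc, hne, sub_self]; norm_num
    simp [this]
  obtain ⟨y, hy⟩ : ∃ y, φ y ≠ ψ y := by
    by_contra hcon
    push Not at hcon
    exact hne (DFunLike.ext _ _ hcon)
  by_cases hadj : Adjacent (ofEmbedding φ) (ofEmbedding ψ)
  · rw [if_pos hadj, ← Finset.sum_product', ← Finset.sum_filter, Finset.sum_const, nsmul_eq_mul]
    refine mul_le_mul_of_nonneg_right ?_ hc0
    -- A transposition that changes `φ y` to `ψ y` is determined; its two orderings give the factor
    -- 2.
    have hsub : (Finset.univ ×ˢ Finset.univ).filter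
        (fun x : Fin n × Fin n => Equiv.swap x.1 x.2 • φ = ψ) ⊆ {(φ y, ψ y), (ψ y, φ y)} := by
      rintro ⟨k, a⟩ hka
      rcases eq_or_eq_of_swap_smul hy (Finset.mem_filter.1 hka).2 with ⟨rfl, rfl⟩ | ⟨rfl, rfl⟩ <;>
        simp
    exact_mod_cast (Finset.card_le_card hsub).trans Finset.card_le_two
  · rw [if_neg hadj, mul_zero]
    refine Finset.sum_nonpos fun k _ => Finset.sum_nonpos fun a _ => ?_
    rw [if_neg fun h => hadj (adjacent_of_swap_smul hmn hy h)]

/-- The Poincaré inequality of the adjacency graph of perfect matchings. -/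
theorem sum_sum_sq_sub_le_adjacent (hmn : m ≤ n) (F : PerfectMatching m n → ℝ) :
    ∑ M, ∑ M', (F M - F M') ^ 2 ≤ Fintype.card (PerfectMatching m n) * (2 * n *
      ∑ M, ∑ M', if Adjacent M M' then (F M - F M') ^ 2 else 0) := by
  have hb := ofEmbedding_bijective hmn
  have : MulAction.IsPretransitive (Equiv.Perm (Fin n)) (Fin m ↪ Fin n) :=
    Equiv.Perm.isMultiplyPretransitive (Fin n) m
  have key := sum_sum_sq_sub_le (n := n) fun φ : Fin m ↪ Fin n => F (ofEmbedding φ)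
  have hswap : ∑ k : Fin n, ∑ a : Fin n, ∑ φ : Fin m ↪ Fin n,
      (F (ofEmbedding φ) - F (ofEmbedding (Equiv.swap k a • φ))) ^ 2 ≤
      ∑ φ : Fin m ↪ Fin n, ∑ ψ : Fin m ↪ Fin n,
        2 * if Adjacent (ofEmbedding φ) (ofEmbedding ψ) then
          (F (ofEmbedding φ) - F (ofEmbedding ψ)) ^ 2 else 0 := by
    calc _ = ∑ φ : Fin m ↪ Fin n, ∑ ψ : Fin m ↪ Fin n, ∑ k : Fin n, ∑ a : Fin n,
          if Equiv.swap k a • φ = ψ then (F (ofEmbedding φ) - F (ofEmbedding ψ)) ^ 2 else 0 := by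
          -- The sums are reordered so that `ψ` is innermost; the indicator of `Equiv.swap k a • φ =
          -- ψ` then selects a single term.
          refine ((Finset.sum_congr rfl fun k _ => Finset.sum_comm).trans Finset.sum_comm).trans ?_
          refine Finset.sum_congr rfl fun φ _ => ?_
          refine .trans ?_ (Finset.sum_comm.trans
            (Finset.sum_congr rfl fun k _ => Finset.sum_comm)).symm
          simp
      _ ≤ _ := Finset.sum_le_sum fun φ _ => Finset.sum_le_sum fun ψ _ => sum_swap_ite_le hmn F φ ψ
  have e1 : ∑ M, ∑ M', (F M - F M') ^ 2 = ∑ φ : Fin m ↪ Fin n, ∑ ψ : Fin m ↪ Fin n,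
      (F (ofEmbedding φ) - F (ofEmbedding ψ)) ^ 2 := by
    rw [← hb.sum_comp]
    exact Finset.sum_congr rfl fun φ _ => (hb.sum_comp _).symm
  have e2 : (∑ M, ∑ M', if Adjacent M M' then (F M - F M') ^ 2 else 0) =
      ∑ φ : Fin m ↪ Fin n, ∑ ψ : Fin m ↪ Fin n,
        if Adjacent (ofEmbedding φ) (ofEmbedding ψ) then
          (F (ofEmbedding φ) - F (ofEmbedding ψ)) ^ 2 else 0 := by
    rw [← hb.sum_comp]
    exact Finset.sum_congr rfl fun φ _ => (hb.sum_comp _).symm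
  rw [e1, e2, ← Fintype.card_of_bijective hb]
  refine key.trans (mul_le_mul_of_nonneg_left ?_ (Nat.cast_nonneg _))
  calc _ ≤ _ := mul_le_mul_of_nonneg_left hswap (Nat.cast_nonneg n)
    _ = _ := by simp only [← Finset.mul_sum]; ring

theorem card_perfectMatching_le (hmn : m ≤ n) :
    Fintype.card (PerfectMatching m n) ≤ n ^ m := by
  rw [← Fintype.card_of_bijective (ofEmbedding_bijective hmn), Fintype.card_embedding_eq]
  simpa using Nat.descFactorial_le_pow n m

theorem nonempty_perfectMatching (hmn : m ≤ n) : Nonempty (PerfectMatching m n) :=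
  ⟨ofEmbedding (Fin.castLEEmb hmn)⟩

end Embeddings

/-! ### Gibbs weights and comparison with the uniform weight -/

section Gibbs

variable {m n : ℕ} {β : ℝ} {U : PerfectMatching m n → ℝ}

theorem acceptProb_le_one (M M' : PerfectMatching m n) : acceptProb β U M M' ≤ 1 :=
  min_le_left _ _

theorem acceptProb_nonneg (M M' : PerfectMatching m n) : 0 ≤ acceptProb β U M M' :=
  le_min zero_le_one (Real.exp_pos _).le

theorem acceptProb_self (M : PerfectMatching m n) : acceptProb β U M M = 1 := by
  simp [acceptProb]

theorem partition_pos (hmn : m ≤ n) : 0 < ∑ M' : PerfectMatching m n, Real.exp (β * U M') :=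
  have := nonempty_perfectMatching hmn
  Finset.sum_pos (fun _ _ => Real.exp_pos _) Finset.univ_nonempty

theorem gibbs_pos (hmn : m ≤ n) (M : PerfectMatching m n) : 0 < gibbs β U M :=
  div_pos (Real.exp_pos _) (partition_pos hmn)

theorem sum_gibbs (hmn : m ≤ n) : ∑ M, gibbs β U M = 1 := by
  simp only [gibbs, ← Finset.sum_div]
  exact div_self (partition_pos hmn).ne'

/-- The Metropolis rule makes the flow symmetric, which gives detailed balance, and at least any
common lower bound of the weights. -/
theorem gibbs_mul_acceptProb (hmn : m ≤ n) (M M' : PerfectMatching m n) :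
    gibbs β U M * acceptProb β U M M' = min (gibbs β U M) (gibbs β U M') := by
  rw [acceptProb, mul_min_of_nonneg _ _ (gibbs_pos hmn M).le, mul_one]
  congr 1
  rw [gibbs, gibbs, div_mul_eq_mul_div, ← Real.exp_add]
  congr 2
  ring

theorem gibbs_mul_acceptProb_comm (hmn : m ≤ n) (M M' : PerfectMatching m n) :
    gibbs β U M * acceptProb β U M M' = gibbs β U M' * acceptProb β U M' M := by
  rw [gibbs_mul_acceptProb hmn, gibbs_mul_acceptProb hmn, min_comm]

theorem le_Umax (M : PerfectMatching m n) : U M ≤ Umax U :=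
  le_ciSup (Set.finite_range U).bddAbove M

theorem Umin_le (M : PerfectMatching m n) : Umin U ≤ U M :=
  ciInf_le (Set.finite_range U).bddBelow M

theorem one_le_alpha (hmn : m ≤ n) (hβ : 0 ≤ β) : 1 ≤ alpha β U := by
  obtain ⟨M⟩ := nonempty_perfectMatching hmn
  exact Real.one_le_exp (mul_nonneg hβ (sub_nonneg.2 ((Umin_le M).trans (le_Umax M))))

/-- A lower bound `g` for the Gibbs weights, up to the factor `α` an upper bound. -/
theorem exists_gibbs_bounds (hmn : m ≤ n) (hβ : 0 ≤ β) (U : PerfectMatching m n → ℝ) :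
    ∃ g : ℝ, 0 < g ∧ (∀ M, g ≤ gibbs β U M) ∧ (∀ M, gibbs β U M ≤ alpha β U * g) := by
  have hZ := partition_pos (β := β) (U := U) hmn
  refine ⟨Real.exp (β * Umin U) / ∑ M' : PerfectMatching m n, Real.exp (β * U M'),
    div_pos (Real.exp_pos _) hZ, fun M => ?_, fun M => ?_⟩
  · exact div_le_div_of_nonneg_right
      (Real.exp_le_exp.2 (mul_le_mul_of_nonneg_left (Umin_le M) hβ)) hZ.le
  · rw [alpha, mul_div_assoc', ← Real.exp_add]
    refine div_le_div_of_nonneg_right (Real.exp_le_exp.2 ?_) hZ.le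
    have := mul_le_mul_of_nonneg_left (le_Umax (U := U) M) hβ
    linarith

theorem card_mul_le_one (hmn : m ≤ n) {g : ℝ} (hg : ∀ M, g ≤ gibbs β U M) :
    Fintype.card (PerfectMatching m n) * g ≤ 1 := by
  have := Finset.sum_le_sum fun M (_ : M ∈ Finset.univ) => hg M
  rwa [sum_gibbs hmn, Finset.sum_const, nsmul_eq_mul] at this

/-- The weights sum to one, are at most `α g` each, and number at most `n ^ m`; hence `g` is at
least `1 / (α n ^ m)`. -/
theorem exp_neg_le_gibbs (hm : 1 ≤ m) (hmn : m ≤ n) (hβ : 0 ≤ β) (M : PerfectMatching m n) :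
    Real.exp (-(β * (Umax U - Umin U) + m * Real.log n)) ≤ gibbs β U M := by
  obtain ⟨g, hg0, hg1, hg2⟩ := exists_gibbs_bounds hmn hβ U
  refine le_trans ?_ (hg1 M)
  have hn : (0 : ℝ) < n := by exact_mod_cast hm.trans hmn
  have hα : 0 < alpha β U := Real.exp_pos _
  have h1 : 1 ≤ Fintype.card (PerfectMatching m n) * (alpha β U * g) := by
    have := Finset.sum_le_sum fun M (_ : M ∈ Finset.univ) => hg2 M
    rwa [sum_gibbs hmn, Finset.sum_const, nsmul_eq_mul] at this
  have h2 : (Fintype.card (PerfectMatching m n) : ℝ) ≤ (n : ℝ) ^ m := by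
    exact_mod_cast card_perfectMatching_le hmn
  have h3 : Real.exp (β * (Umax U - Umin U) + m * Real.log n) = alpha β U * (n : ℝ) ^ m := by
    rw [Real.exp_add, Real.exp_nat_mul, Real.exp_log hn, alpha]
  rw [Real.exp_neg, h3, inv_le_iff_one_le_mul₀ (by positivity)]
  calc (1 : ℝ) ≤ _ := h1
    _ ≤ (n : ℝ) ^ m * (alpha β U * g) := mul_le_mul_of_nonneg_right h2 (by positivity)
    _ = _ := by ring

/-- The comparison itself needs only `4 m n² α²`; the stated constant leaves a spare factor `8 m
α⁴`. -/
theorem poincare_constant_le {m n α g N A : ℝ} (hm : 1 ≤ m) (hn : 1 ≤ n) (hα : 1 ≤ α)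
    (hg : 0 ≤ g) (hN : 0 ≤ N) (hNg : N * g ≤ 1) (hA : 0 ≤ A) :
    (32 * m ^ 2 * n ^ 2 * α ^ 6)⁻¹ * ((α * g) ^ 2 * (N * (2 * n * A))) ≤
      1 / (2 * m * n) * g * A := by
  have h3 : (α * g) ^ 2 * (N * (2 * n * A)) ≤ α ^ 6 * (g * (2 * n * A)) := by
    calc (α * g) ^ 2 * (N * (2 * n * A)) = α ^ 2 * (N * g) * (g * (2 * n * A)) := by ring
      _ ≤ α ^ 6 * 1 * (g * (2 * n * A)) := by
          refine mul_le_mul_of_nonneg_right ?_ (by positivity)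
          exact mul_le_mul (pow_le_pow_right₀ hα (by norm_num)) hNg (by positivity) (by positivity)
      _ = _ := by ring
  calc _ ≤ (32 * m ^ 2 * n ^ 2 * α ^ 6)⁻¹ * (α ^ 6 * (g * (2 * n * A))) :=
        mul_le_mul_of_nonneg_left h3 (by positivity)
    _ = 1 / (8 * m) * (1 / (2 * m * n) * g * A) := by field_simp; ring
    _ ≤ 1 * (1 / (2 * m * n) * g * A) := by
        refine mul_le_mul_of_nonneg_right ?_ (by positivity)
        rw [div_le_one (by positivity)]
        linarith
    _ = _ := one_mul _

theorem gibbs_poincare (hm : 1 ≤ m) (hmn : m ≤ n) (hβ : 0 ≤ β)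
    {P : Matrix (PerfectMatching m n) (PerfectMatching m n) ℝ} (hP0 : ∀ M M', 0 ≤ P M M')
    (hP : ∀ M M', Adjacent M M' → 1 / (2 * (m : ℝ) * n) * acceptProb β U M M' ≤ P M M')
    (F : PerfectMatching m n → ℝ) :
    (32 * (m : ℝ) ^ 2 * (n : ℝ) ^ 2 * alpha β U ^ 6)⁻¹ *
        ∑ M, ∑ M', gibbs β U M * gibbs β U M' * (F M - F M') ^ 2 ≤
      ∑ M, ∑ M', gibbs β U M * P M M' * (F M - F M') ^ 2 := by
  obtain ⟨g, hg0, hg1, hg2⟩ := exists_gibbs_bounds hmn hβ U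
  have hNg := card_mul_le_one hmn hg1
  have hα := one_le_alpha (U := U) hmn hβ
  have hm' : (1 : ℝ) ≤ m := by exact_mod_cast hm
  have hn' : (1 : ℝ) ≤ n := by exact_mod_cast hm.trans hmn
  set α := alpha β U
  set N : ℝ := (Fintype.card (PerfectMatching m n) : ℝ)
  have hN : 0 ≤ N := Nat.cast_nonneg _
  set A : ℝ := ∑ M : PerfectMatching m n, ∑ M', if Adjacent M M' then (F M - F M') ^ 2 else 0
    with hA
  have hA0 : 0 ≤ A := Finset.sum_nonneg fun M _ => Finset.sum_nonneg fun M' _ => by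
    split_ifs
    exacts [sq_nonneg _, le_rfl]
  have h1 : ∑ M, ∑ M', gibbs β U M * gibbs β U M' * (F M - F M') ^ 2 ≤
      (α * g) ^ 2 * (N * (2 * n * A)) := by
    refine le_trans ?_ (mul_le_mul_of_nonneg_left (sum_sum_sq_sub_le_adjacent hmn F) (sq_nonneg _))
    simp only [Finset.mul_sum]
    refine Finset.sum_le_sum fun M _ => Finset.sum_le_sum fun M' _ => ?_
    refine mul_le_mul_of_nonneg_right ?_ (sq_nonneg _)
    rw [sq]
    exact mul_le_mul (hg2 M) (hg2 M') (gibbs_pos hmn M').le (by positivity)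
  have h2 : 1 / (2 * (m : ℝ) * n) * g * A ≤
      ∑ M, ∑ M', gibbs β U M * P M M' * (F M - F M') ^ 2 := by
    rw [hA]
    simp only [Finset.mul_sum]
    refine Finset.sum_le_sum fun M _ => Finset.sum_le_sum fun M' _ => ?_
    split_ifs with hadj
    · refine mul_le_mul_of_nonneg_right ?_ (sq_nonneg _)
      calc 1 / (2 * (m : ℝ) * n) * g
          ≤ 1 / (2 * (m : ℝ) * n) * (gibbs β U M * acceptProb β U M M') := by
            rw [gibbs_mul_acceptProb hmn]
            exact mul_le_mul_of_nonneg_left (le_min (hg1 M) (hg1 M')) (by positivity)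
        _ = gibbs β U M * (1 / (2 * (m : ℝ) * n) * acceptProb β U M M') := by ring
        _ ≤ _ := mul_le_mul_of_nonneg_left (hP M M' hadj) (gibbs_pos hmn M).le
    · rw [mul_zero]
      exact mul_nonneg (mul_nonneg (gibbs_pos hmn M).le (hP0 M M')) (sq_nonneg _)
  exact (mul_le_mul_of_nonneg_left h1 (by positivity)).trans
    ((poincare_constant_le hm' hn' hα hg0.le hN hNg hA0).trans h2)

/-! ### The two transition matrices -/

theorem algorithmMatrix_apply_of_ne {M M' : PerfectMatching m n} (h : M ≠ M') :
    algorithmMatrix β U M M' = 1 / ((m : ℝ) * n) * acceptProb β U M M' *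
      ∑ y : Fin m, ∑ z : Fin n, if propose M y z = M' then (1 : ℝ) else 0 := by
  simp only [algorithmMatrix, if_neg h, add_zero, Finset.mul_sum]
  refine Finset.sum_congr rfl fun y _ => Finset.sum_congr rfl fun z _ => ?_
  split_ifs with hp
  · rw [hp, mul_one]
  · simp

theorem algorithmMatrix_summand_nonneg (M M' : PerfectMatching m n) (y : Fin m) (z : Fin n) :
    0 ≤ 1 / ((m : ℝ) * n) *
      ((if propose M y z = M' then acceptProb β U M (propose M y z) else 0) +
        (if M = M' then 1 - acceptProb β U M (propose M y z) else 0)) := by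
  have h0 := acceptProb_nonneg (β := β) (U := U) M (propose M y z)
  have h1 := acceptProb_le_one (β := β) (U := U) M (propose M y z)
  refine mul_nonneg (by positivity) (add_nonneg ?_ ?_) <;> split_ifs <;> linarith

theorem algorithmMatrix_isReversible (hm : 1 ≤ m) (hmn : m ≤ n) :
    IsReversible (algorithmMatrix β U) (gibbs β U) where
  pos := gibbs_pos hmn
  sum_eq_one := sum_gibbs hmn
  row_sum M := by
    have hm' : (m : ℝ) ≠ 0 := by exact_mod_cast (by omega : m ≠ 0)
    have hn' : (n : ℝ) ≠ 0 := by exact_mod_cast (by omega : n ≠ 0)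
    simp only [algorithmMatrix]
    rw [Finset.sum_comm, Finset.sum_congr rfl fun y _ => Finset.sum_comm]
    simp only [← Finset.mul_sum, Finset.sum_add_distrib, Finset.sum_ite_eq, Finset.mem_univ,
      if_true]
    simp
    field_simp
  balance M M' := by
    by_cases h : M = M'
    · rw [h]
    · rw [algorithmMatrix_apply_of_ne h, algorithmMatrix_apply_of_ne (Ne.symm h),
        sum_propose_comm hmn M M']
      linear_combination (1 / ((m : ℝ) * n) *
        ∑ y : Fin m, ∑ z : Fin n, if propose M' y z = M then (1 : ℝ) else 0) *
          gibbs_mul_acceptProb_comm (β := β) (U := U) hmn M M'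

theorem algorithmMatrix_nonneg (M M' : PerfectMatching m n) : 0 ≤ algorithmMatrix β U M M' :=
  Finset.sum_nonneg fun y _ => Finset.sum_nonneg fun z _ =>
    algorithmMatrix_summand_nonneg M M' y z

/-- For each of the `m` choices of `y`, selecting its current partner proposes `M` itself, which is
always accepted. -/
theorem le_algorithmMatrix_self (hm : 1 ≤ m) (hmn : m ≤ n) (M : PerfectMatching m n) :
    1 / (n : ℝ) ≤ algorithmMatrix β U M M := by
  have hm' : (m : ℝ) ≠ 0 := by exact_mod_cast (by omega : m ≠ 0)
  obtain ⟨φ, hφ⟩ := (ofEmbedding_bijective hmn).2 M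
  have hself : ∀ y, propose M y (φ y) = M := fun y => by
    rw [← hφ, propose_ofEmbedding, Equiv.swap_self]
    rfl
  calc 1 / (n : ℝ) = ∑ _y : Fin m, 1 / ((m : ℝ) * n) := by
        simp only [Finset.sum_const, Finset.card_univ, Fintype.card_fin, nsmul_eq_mul]
        rw [mul_one_div, div_mul_cancel_left₀ hm', one_div]
    _ ≤ _ := Finset.sum_le_sum fun y _ => by
        refine le_trans (le_of_eq ?_) (Finset.single_le_sum
          (fun z _ => algorithmMatrix_summand_nonneg (β := β) (U := U) M M y z)
          (Finset.mem_univ (φ y)))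
        simp [hself, acceptProb_self]

theorem le_algorithmMatrix_of_adjacent {M M' : PerfectMatching m n} (h : Adjacent M M') :
    1 / (2 * (m : ℝ) * n) * acceptProb β U M M' ≤ algorithmMatrix β U M M' := by
  obtain ⟨hne, y, z, hyz⟩ := h
  have h1 : (1 : ℝ) ≤ ∑ y : Fin m, ∑ z : Fin n, if propose M y z = M' then (1 : ℝ) else 0 := by
    have h0 : ∀ y z, (0 : ℝ) ≤ if propose M y z = M' then (1 : ℝ) else 0 := fun y z => by
      split_ifs <;> norm_num
    calc (1 : ℝ) = if propose M y z = M' then (1 : ℝ) else 0 := (if_pos hyz).symm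
      _ ≤ ∑ z : Fin n, if propose M y z = M' then (1 : ℝ) else 0 :=
        Finset.single_le_sum (f := fun z => if propose M y z = M' then (1 : ℝ) else 0)
          (fun z _ => h0 y z) (Finset.mem_univ z)
      _ ≤ _ := Finset.single_le_sum
          (f := fun y => ∑ z : Fin n, if propose M y z = M' then (1 : ℝ) else 0)
          (fun y _ => Finset.sum_nonneg fun z _ => h0 y z) (Finset.mem_univ y)
  rw [algorithmMatrix_apply_of_ne hne]
  have ha := acceptProb_nonneg (β := β) (U := U) M M'
  have hc : (0 : ℝ) ≤ 1 / ((m : ℝ) * n) * acceptProb β U M M' := by positivity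
  calc _ = 1 / 2 * (1 / ((m : ℝ) * n) * acceptProb β U M M') := by
        rw [mul_assoc 2, one_div_mul_eq_div, ← div_div]; ring
    _ ≤ 1 / ((m : ℝ) * n) * acceptProb β U M M' * 1 := by linarith
    _ ≤ _ := mul_le_mul_of_nonneg_left h1 hc

theorem card_adjacent_le (M : PerfectMatching m n) :
    (Finset.univ.filter fun N => Adjacent M N).card ≤ m * n := by
  have hsub : (Finset.univ.filter fun N => Adjacent M N) ⊆
      (Finset.univ : Finset (Fin m × Fin n)).image fun p => propose M p.1 p.2 := by
    intro N hN
    obtain ⟨-, y, z, h⟩ := (Finset.mem_filter.1 hN).2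
    exact Finset.mem_image.2 ⟨(y, z), Finset.mem_univ _, h⟩
  simpa using (Finset.card_le_card hsub).trans Finset.card_image_le

/-- At most `m n` states are adjacent, and each is entered with probability at most `1 / (2 m n)`.
-/
theorem half_le_lazyMatrix_self (M : PerfectMatching m n) :
    1 / 2 ≤ lazyMatrix β U M M := by
  rw [lazyMatrix, if_pos rfl]
  have h : ∑ N : PerfectMatching m n,
      (if Adjacent M N then 1 / (2 * (m : ℝ) * n) * acceptProb β U M N else 0) ≤ 1 / 2 := by
    rw [← Finset.sum_filter]
    calc _ ≤ ∑ _N ∈ Finset.univ.filter fun N => Adjacent M N, 1 / (2 * (m : ℝ) * n) :=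
          Finset.sum_le_sum fun N _ => mul_le_of_le_one_right (by positivity)
            (acceptProb_le_one M N)
      _ ≤ ((m * n : ℕ) : ℝ) * (1 / (2 * (m : ℝ) * n)) := by
          rw [Finset.sum_const, nsmul_eq_mul]
          exact mul_le_mul_of_nonneg_right (Nat.cast_le.2 (card_adjacent_le M)) (by positivity)
      _ ≤ 1 / 2 := by
          rw [mul_one_div]
          refine div_le_of_le_mul₀ (by positivity) (by norm_num) ?_
          push_cast
          linarith
  linarith

theorem lazyMatrix_nonneg (M M' : PerfectMatching m n) : 0 ≤ lazyMatrix β U M M' := by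
  by_cases h : M = M'
  · subst h
    exact le_trans (by norm_num) (half_le_lazyMatrix_self M)
  · rw [lazyMatrix, if_neg h]
    have := acceptProb_nonneg (β := β) (U := U) M M'
    split_ifs <;> positivity

theorem le_lazyMatrix_of_adjacent {M M' : PerfectMatching m n} (h : Adjacent M M') :
    1 / (2 * (m : ℝ) * n) * acceptProb β U M M' ≤ lazyMatrix β U M M' := by
  rw [lazyMatrix, if_neg h.1, if_pos h]

theorem lazyMatrix_isReversible (hmn : m ≤ n) :
    IsReversible (lazyMatrix β U) (gibbs β U) where
  pos := gibbs_pos hmn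
  sum_eq_one := sum_gibbs hmn
  row_sum M := by
    have hoff : ∀ M', lazyMatrix β U M M' =
        (if M = M' then 1 - ∑ N : PerfectMatching m n,
          if Adjacent M N then 1 / (2 * (m : ℝ) * n) * acceptProb β U M N else 0 else 0) +
        if Adjacent M M' then 1 / (2 * (m : ℝ) * n) * acceptProb β U M M' else 0 := by
      intro M'
      rw [lazyMatrix]
      by_cases h : M = M'
      · have : ¬ Adjacent M M' := fun hc => hc.1 h
        rw [if_pos h, if_pos h, if_neg this, add_zero]
      · rw [if_neg h, if_neg h, zero_add]
    rw [Finset.sum_congr rfl fun M' _ => hoff M', Finset.sum_add_distrib, Finset.sum_ite_eq,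
      if_pos (Finset.mem_univ M), sub_add_cancel]
  balance M M' := by
    by_cases h : M = M'
    · rw [h]
    · rw [lazyMatrix, lazyMatrix, if_neg h, if_neg (Ne.symm h)]
      by_cases hadj : Adjacent M M'
      · rw [if_pos hadj, if_pos (hadj.symm hmn)]
        linear_combination 1 / (2 * (m : ℝ) * n) *
          gibbs_mul_acceptProb_comm (β := β) (U := U) hmn M M'
      · rw [if_neg hadj, if_neg fun hc => hadj (hc.symm hmn)]
        simp

/-- Isolates what both chains share: rates at least those of the lazy chain, and holding probability
at least `1 / (2 n)`, ample since the gap constant is below `1 / n`. -/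
theorem hasGap_of_isReversible (hm : 1 ≤ m) (hmn : m ≤ n) (hβ : 0 ≤ β)
    {P : Matrix (PerfectMatching m n) (PerfectMatching m n) ℝ}
    (hrev : IsReversible P (gibbs β U)) (hP0 : ∀ M M', 0 ≤ P M M')
    (hP : ∀ M M', Adjacent M M' → 1 / (2 * (m : ℝ) * n) * acceptProb β U M M' ≤ P M M')
    (hdiag : ∀ M, 1 / (2 * (n : ℝ)) ≤ P M M) :
    HasGap P (gibbs β U) (32 * (m : ℝ) ^ 2 * (n : ℝ) ^ 2 * alpha β U ^ 6)⁻¹ := by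
  have hα := one_le_alpha (U := U) hmn hβ
  have hm' : (1 : ℝ) ≤ m := by exact_mod_cast hm
  have hn' : (1 : ℝ) ≤ n := by exact_mod_cast hm.trans hmn
  have hK : (n : ℝ) < 32 * (m : ℝ) ^ 2 * (n : ℝ) ^ 2 * alpha β U ^ 6 := by
    calc (n : ℝ) < 32 * 1 * ((n : ℝ) * 1) * 1 := by linarith
      _ ≤ 32 * (m : ℝ) ^ 2 * ((n : ℝ) * n) * alpha β U ^ 6 := by
          gcongr
          · exact one_le_pow₀ hm'
          · exact one_le_pow₀ hα
      _ = _ := by ring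
  refine ⟨hrev, hP0, by positivity, inv_lt_one_of_one_lt₀ (hn'.trans_lt hK), fun M => ?_,
    gibbs_poincare hm hmn hβ hP0 hP⟩
  calc _ ≤ (n : ℝ)⁻¹ := inv_anti₀ (by positivity) hK.le
    _ = 2 * (1 / (2 * (n : ℝ))) := by field_simp
    _ ≤ _ := mul_le_mul_of_nonneg_left (hdiag M) (by norm_num)

end Gibbs

end MatchingChain

/-! ### The mixing time bound for both chains -/

theorem mainTheorem2 (m n : ℕ) (hm : 1 ≤ m) (hmn : m ≤ n)
    (U : MatchingChain.PerfectMatching m n → ℝ) (β : ℝ) (hβ : 0 ≤ β)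
    (ε : ℝ) (hε : 0 < ε) (hε1 : ε ≤ 1)
    (P : Matrix (MatchingChain.PerfectMatching m n) (MatchingChain.PerfectMatching m n) ℝ)
    (hP : P = MatchingChain.algorithmMatrix β U ∨ P = MatchingChain.lazyMatrix β U) :
    (∀ π : MatchingChain.PerfectMatching m n → ℝ,
        MatchingChain.IsStationaryDistribution P π ↔ π = MatchingChain.gibbs β U) ∧
      ∃ τ : ℕ, MatchingChain.IsMixingTime P (MatchingChain.gibbs β U) ε τ ∧
        (τ : ℝ) ≤ 32 * (m : ℝ) ^ 2 * (n : ℝ) ^ 2 * MatchingChain.alpha β U ^ 6 *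
          (β * (MatchingChain.Umax U - MatchingChain.Umin U) + m * Real.log n +
            Real.log ε⁻¹) := by
  have hne := MatchingChain.nonempty_perfectMatching hmn
  have hm' : (1 : ℝ) ≤ m := by exact_mod_cast hm
  have hn' : (1 : ℝ) ≤ n := by exact_mod_cast hm.trans hmn
  have hα := MatchingChain.one_le_alpha (U := U) hmn hβ
  have hgap : MatchingChain.HasGap P (MatchingChain.gibbs β U)
      (32 * (m : ℝ) ^ 2 * (n : ℝ) ^ 2 * MatchingChain.alpha β U ^ 6)⁻¹ := by
    rcases hP with rfl | rfl
    · refine MatchingChain.hasGap_of_isReversible hm hmn hβ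
        (MatchingChain.algorithmMatrix_isReversible hm hmn) MatchingChain.algorithmMatrix_nonneg
        (fun _ _ => MatchingChain.le_algorithmMatrix_of_adjacent) fun M => ?_
      refine le_trans ?_ (MatchingChain.le_algorithmMatrix_self hm hmn M)
      exact one_div_le_one_div_of_le (by positivity) (by linarith)
    · refine MatchingChain.hasGap_of_isReversible hm hmn hβ
        (MatchingChain.lazyMatrix_isReversible hmn) MatchingChain.lazyMatrix_nonneg
        (fun _ _ => MatchingChain.le_lazyMatrix_of_adjacent) fun M => ?_
      refine le_trans ?_ (MatchingChain.half_le_lazyMatrix_self M)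
      exact one_div_le_one_div_of_le (by positivity) (by linarith)
  refine ⟨hgap.isStationary_iff, ?_⟩
  have hδ : (32 * (m : ℝ) ^ 2 * (n : ℝ) ^ 2 * MatchingChain.alpha β U ^ 6)⁻¹ ≤ 1 / 2 := by
    rw [one_div]
    refine inv_anti₀ (by norm_num) ?_
    calc (2 : ℝ) ≤ 32 * 1 * 1 * 1 := by norm_num
      _ ≤ _ := by
        gcongr
        · exact one_le_pow₀ hm'
        · exact one_le_pow₀ hn'
        · exact one_le_pow₀ hα
  have hL0 : 0 ≤ β * (MatchingChain.Umax U - MatchingChain.Umin U) + m * Real.log n := by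
    have h1 := Real.log_nonneg hα
    rw [MatchingChain.alpha, Real.log_exp] at h1
    exact add_nonneg h1 (mul_nonneg (Nat.cast_nonneg m) (Real.log_nonneg hn'))
  obtain ⟨τ, h1, h2⟩ := hgap.exists_mixingTime_le hδ hL0
    (MatchingChain.exp_neg_le_gibbs hm hmn hβ) hε hε1
  exact ⟨τ, h1, by rwa [inv_inv] at h2⟩
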